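/- Let $H$ be a separable complex Hilbert space and let $\Sigma$ be an operator measure on $\mathbb R$ in $H$, that is, a function $\delta\mapsto\Sigma(\delta)$ from the bounded Borel subsets of $\mathbb R$ to the nonnegative bounded self-adjoint operators on $H$ that is countably additive in the strong operator topology: $\Sigma(\bigcup_i\delta_i)f=\sum_i\Sigma(\delta_i)f$ for all $f\in H$ and all pairwise disjoint Borel sets $\delta_i$ with bounded union. For $f\in H$ put $\mu_f(\delta):=(\Sigma(\delta)f,f)$, and let $$\Omega_\Sigma:=\{f\in H:\ \mu_f\sim\Sigma\}$$ be the set of vectors of maximal type, where $\mu_f\sim\Sigma$ means that, for every bounded Borel set $\delta$, $\mu_f(\delta)=0$ if and only if $\Sigma(\delta)=0$. Then: (a) $H\setminus\Omega_\Sigma$ is an $F_\sigma$-set of first category in $H$; (b) $\omega(\Omega_\Sigma)=1$ for every nondegenerate Gaussian measure $\omega$ on $H$, i.e. for every (not necessarily centred) Gaussian Borel measure $\omega$ on $H$ that is not concentrated on a proper closed linear subspace of $H$. In particular, $\Omega_\Sigma$ is nonempty and dense in $H$. -/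

import Mathlib

open MeasureTheory ProbabilityTheory Set Topology

/-- A (nonnegative, not necessarily orthogonal) operator measure on the line in the Hilbert space
`H`: a set function on the bounded Borel subsets of `ℝ`, with values in the nonnegative bounded
operators, which is countably additive in the strong operator topology. The values on other sets
are irrelevant. Such measures correspond to the nondecreasing strongly left continuous
operator functions `S` on `ℝ`, up to an additive constant, via `Σ [a, b) = S b - S a`. -/
structure OperatorMeasure (H : Type*) [NormedAddCommGroup H] [InnerProductSpace ℂ H]
    [CompleteSpace H] where
  /-- the underlying set function -/
  toFun : Set ℝ → H →L[ℂ] H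
  /-- the values are nonnegative self-adjoint operators -/
  isPositive : ∀ δ : Set ℝ, MeasurableSet δ → Bornology.IsBounded δ → (toFun δ).IsPositive
  /-- the empty set has measure zero -/
  empty : toFun ∅ = 0
  /-- strong countable additivity on bounded Borel sets -/
  hasSum_iUnion : ∀ δ : ℕ → Set ℝ, (∀ i, MeasurableSet (δ i)) →
    Pairwise (fun i j => Disjoint (δ i) (δ j)) → Bornology.IsBounded (⋃ i, δ i) →
    ∀ f : H, HasSum (fun i => toFun (δ i) f) (toFun (⋃ i, δ i) f)

/-- `σ ≺ τ` for (operator or scalar) set functions on the bounded Borel sets: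
`σ δ = 0` whenever `τ δ = 0`. -/
def MeasSubordinate {M N : Type*} [Zero M] [Zero N] (σ : Set ℝ → M) (τ : Set ℝ → N) : Prop :=
  ∀ δ : Set ℝ, MeasurableSet δ → Bornology.IsBounded δ → τ δ = 0 → σ δ = 0

/-- `σ ∼ τ`: each of the two is subordinate to the other one. -/
def MeasEquivalent {M N : Type*} [Zero M] [Zero N] (σ : Set ℝ → M) (τ : Set ℝ → N) : Prop :=
  MeasSubordinate σ τ ∧ MeasSubordinate τ σ

/-- A set is `F_σ` if it is a countable union of closed sets. -/
def IsFsigma {X : Type*} [TopologicalSpace X] (s : Set X) : Prop :=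
  ∃ F : ℕ → Set X, (∀ n, IsClosed (F n)) ∧ s = ⋃ n, F n

section

variable {H : Type*} [NormedAddCommGroup H] [InnerProductSpace ℂ H] [CompleteSpace H]

/-- The scalar measure `μ_f(δ) = Re (S(δ) f, f) = (S(δ) f, f)` (a nonnegative real number for bounded Borel `δ`). -/
noncomputable def OperatorMeasure.scalar (S : OperatorMeasure H) (f : H) : Set ℝ → ℝ :=
  fun δ => (S.toFun δ).reApplyInnerSelf f

/-- The set of vectors of maximal type: those `f` for which `S ∼ μ_f`. -/
def OperatorMeasure.maximalType (S : OperatorMeasure H) : Set H :=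
  {f : H | MeasEquivalent S.toFun (S.scalar f)}

/-- A measure is nondegenerate if it is not concentrated on a proper closed linear subspace. -/
def IsNondegenerate [MeasurableSpace H] (ω : Measure H) : Prop :=
  ∀ L : Submodule ℂ H, IsClosed (L : Set H) → L ≠ ⊤ → ω (L : Set H) ≠ 1

end

open scoped ENNReal NNReal

/-! ### The quadratic form of an operator measure -/

namespace OperatorMeasure

variable {H : Type*} [NormedAddCommGroup H] [InnerProductSpace ℂ H] [CompleteSpace H]

/-! Let τ be a finite measure of the type of Σ and Z_f the essentially largest set on which f is
null. Then f has maximal type iff φ(f) = τ(Z_f) vanishes. Since φ is upper semicontinuous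
(`nonempty_nullSystem`), the vectors of maximal type form a G_δ.

The vectors null on a fixed set form a closed subspace. So if h_k = f + c_k g with distinct c_k, the
sets Z_{h_k} overlap outside Z_f ∩ Z_g with bounded multiplicity; as τ is finite, the values φ(h_k)
cannot all stay above τ(Z_f ∩ Z_g) by a fixed amount (`sum_measure_le_of_triple_inter`). Hence each
nonempty {φ < b} is dense, Baire makes the minimizers of φ dense, and a minimizer has φ = 0, because
a g not null on Z_f would lower the value.

For a Gaussian law, the line is replaced by the circle cos θ · X + sin θ · Y through independent
centred copies, whose law does not depend on θ. The same count gives Z_{X+m} ⊆ Z_{Y+m} almost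
surely. By Fubini, for almost every x the closed subspace of vectors null on Z_x has full measure;
by nondegeneracy it is H, so φ(x) = 0. -/

lemma scalar_eq (S : OperatorMeasure H) (f : H) (δ : Set ℝ) :
    S.scalar f δ = (inner ℂ (S.toFun δ f) f).re := rfl

lemma scalar_nonneg (S : OperatorMeasure H) (f : H) {δ : Set ℝ} (hδ : MeasurableSet δ)
    (hb : Bornology.IsBounded δ) : 0 ≤ S.scalar f δ :=
  (S.isPositive δ hδ hb).2 f

lemma scalar_empty (S : OperatorMeasure H) (f : H) : S.scalar f ∅ = 0 := by
  simp [scalar_eq, S.empty]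

lemma scalar_zero (S : OperatorMeasure H) (δ : Set ℝ) : S.scalar 0 δ = 0 := by
  simp [scalar_eq]

lemma scalar_smul (S : OperatorMeasure H) (c : ℂ) (f : H) (δ : Set ℝ) :
    S.scalar (c • f) δ = ‖c‖ ^ 2 * S.scalar f δ :=
  ContinuousLinearMap.reApplyInnerSelf_smul _ _

lemma continuous_scalar (S : OperatorMeasure H) (δ : Set ℝ) :
    Continuous fun f => S.scalar f δ :=
  (S.toFun δ).reApplyInnerSelf_continuous

lemma scalar_le (S : OperatorMeasure H) (f : H) (δ : Set ℝ) :
    S.scalar f δ ≤ ‖S.toFun δ‖ * ‖f‖ ^ 2 := by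
  calc S.scalar f δ ≤ ‖inner ℂ (S.toFun δ f) f‖ := Complex.re_le_norm _
    _ ≤ ‖S.toFun δ f‖ * ‖f‖ := norm_inner_le_norm _ _
    _ ≤ (‖S.toFun δ‖ * ‖f‖) * ‖f‖ := by gcongr; exact (S.toFun δ).le_opNorm f
    _ = _ := by ring

/-- Parallelogram law, with the nonnegative term at `f - g` dropped. -/
lemma scalar_add_le (S : OperatorMeasure H) (f g : H) {δ : Set ℝ} (hδ : MeasurableSet δ)
    (hb : Bornology.IsBounded δ) :
    S.scalar (f + g) δ ≤ 2 * (S.scalar f δ + S.scalar g δ) := by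
  have h := S.scalar_nonneg (f - g) hδ hb
  have h2 : S.scalar (f + g) δ + S.scalar (f - g) δ = 2 * (S.scalar f δ + S.scalar g δ) := by
    simp only [scalar_eq, map_add, map_sub, inner_add_left, inner_add_right, inner_sub_left,
      inner_sub_right, Complex.add_re, Complex.sub_re]
    ring
  linarith

lemma hasSum_scalar (S : OperatorMeasure H) (f : H) {δ : ℕ → Set ℝ}
    (hδ : ∀ i, MeasurableSet (δ i)) (hd : Pairwise fun i j => Disjoint (δ i) (δ j))
    (hb : Bornology.IsBounded (⋃ i, δ i)) :
    HasSum (fun i => S.scalar f (δ i)) (S.scalar f (⋃ i, δ i)) := by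
  have hc : Continuous fun x : H => (inner ℂ x f).re := by fun_prop
  exact (S.hasSum_iUnion δ hδ hd hb f).map
    (AddMonoidHom.mk' (fun x : H => (inner ℂ x f).re) fun x y => by simp) hc

lemma toFun_eq_zero (S : OperatorMeasure H) {δ : Set ℝ} (hδ : MeasurableSet δ)
    (hb : Bornology.IsBounded δ) (h : ∀ f, S.scalar f δ = 0) : S.toFun δ = 0 := by
  have h0 : ((S.toFun δ : H →L[ℂ] H) : H →ₗ[ℂ] H) = 0 := by
    refine (inner_map_self_eq_zero _).1 fun x => ?_
    have h1 := (S.isPositive δ hδ hb).1.coe_reApplyInnerSelf_apply x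
    have h2 : (S.toFun δ).reApplyInnerSelf x = 0 := h x
    rw [h2] at h1
    simpa using h1.symm
  ext x
  exact LinearMap.congr_fun h0 x

/-! ### Localization to bounded cells and finite scalar measures -/

/-- A partition of the line into countably many bounded Borel cells. -/
def cell (n : ℕ) : Set ℝ := disjointed (fun k : ℕ => Metric.ball (0 : ℝ) k) n

lemma measurableSet_cell (n : ℕ) : MeasurableSet (cell n) :=
  MeasurableSet.disjointed (fun _ => measurableSet_ball) n

lemma isBounded_cell (n : ℕ) : Bornology.IsBounded (cell n) :=
  Metric.isBounded_ball.subset (disjointed_subset _ n)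

lemma isBounded_inter_cell (A : Set ℝ) (n : ℕ) : Bornology.IsBounded (A ∩ cell n) :=
  (isBounded_cell n).subset inter_subset_right

lemma pairwise_disjoint_cell : Pairwise fun i j => Disjoint (cell i) (cell j) :=
  disjoint_disjointed _

lemma iUnion_cell : ⋃ n, cell n = univ := by
  unfold cell
  rw [iUnion_disjointed, Metric.iUnion_ball_nat]

lemma iUnion_inter_cell (A : Set ℝ) : ⋃ n, A ∩ cell n = A := by
  rw [← inter_iUnion, iUnion_cell, inter_univ]

lemma pairwise_disjoint_inter_cell (A : Set ℝ) :
    Pairwise fun i j => Disjoint (A ∩ cell i) (A ∩ cell j) := fun _ _ hij =>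
  (pairwise_disjoint_cell hij).mono inter_subset_right inter_subset_right

/-- The part of `μ_f` in a cell, as a measure on the line. -/
noncomputable def cellMeasure (S : OperatorMeasure H) (f : H) (n : ℕ) : Measure ℝ :=
  Measure.ofMeasurable (fun δ _ => ENNReal.ofReal (S.scalar f (δ ∩ cell n)))
    (by simp [scalar_empty]) (by
      intro A hA hd
      have hs := S.hasSum_scalar f (δ := fun i => A i ∩ cell n)
        (fun i => (hA i).inter (measurableSet_cell n))
        (fun i j hij => (hd hij).mono inter_subset_left inter_subset_left)
        (by rw [← iUnion_inter]; exact isBounded_inter_cell _ n)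
      rw [iUnion_inter, ← hs.tsum_eq, ENNReal.ofReal_tsum_of_nonneg _ hs.summable]
      exact fun i => S.scalar_nonneg f ((hA i).inter (measurableSet_cell n))
        (isBounded_inter_cell _ n))

lemma cellMeasure_apply (S : OperatorMeasure H) (f : H) (n : ℕ) {A : Set ℝ}
    (hA : MeasurableSet A) :
    S.cellMeasure f n A = ENNReal.ofReal (S.scalar f (A ∩ cell n)) :=
  Measure.ofMeasurable_apply A hA

lemma cellMeasure_le (S : OperatorMeasure H) (f : H) (n : ℕ) (A : Set ℝ) :
    S.cellMeasure f n A ≤ ‖S.toFun (cell n)‖ₑ * ‖f‖ₑ ^ 2 := by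
  refine (measure_mono (subset_univ A)).trans ?_
  rw [cellMeasure_apply _ _ _ .univ, univ_inter]
  refine (ENNReal.ofReal_le_ofReal (S.scalar_le f _)).trans_eq ?_
  rw [ENNReal.ofReal_mul (norm_nonneg _), ENNReal.ofReal_pow (norm_nonneg _), ofReal_norm,
    ofReal_norm]

/-- `f` is null on `A`, i.e. `Σ(·) f` vanishes on the bounded Borel subsets of `A`. -/
def NullOn (S : OperatorMeasure H) (f : H) (A : Set ℝ) : Prop :=
  ∀ n, S.scalar f (A ∩ cell n) = 0

lemma NullOn.add {S : OperatorMeasure H} {f g : H} {A : Set ℝ} (hA : MeasurableSet A)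
    (hf : S.NullOn f A) (hg : S.NullOn g A) : S.NullOn (f + g) A := fun n => by
  have hm := hA.inter (measurableSet_cell n)
  refine le_antisymm ?_ (S.scalar_nonneg _ hm (isBounded_inter_cell A n))
  refine (S.scalar_add_le f g hm (isBounded_inter_cell A n)).trans ?_
  simp [hf n, hg n]

lemma NullOn.smul {S : OperatorMeasure H} {f : H} {A : Set ℝ} (c : ℂ) (hf : S.NullOn f A) :
    S.NullOn (c • f) A := fun n => by rw [scalar_smul, hf n, mul_zero]

/-- The closed subspace of the vectors which are null on a given Borel set. -/
def nullSubmodule (S : OperatorMeasure H) (A : Set ℝ) (hA : MeasurableSet A) :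
    Submodule ℂ H where
  carrier := {f | S.NullOn f A}
  add_mem' hf hg := NullOn.add hA hf hg
  zero_mem' _ := S.scalar_zero _
  smul_mem' c _ hf := NullOn.smul c hf

lemma mem_nullSubmodule {S : OperatorMeasure H} {A : Set ℝ} {hA : MeasurableSet A} {f : H} :
    f ∈ S.nullSubmodule A hA ↔ S.NullOn f A := Iff.rfl

lemma isClosed_nullSubmodule (S : OperatorMeasure H) {A : Set ℝ} (hA : MeasurableSet A) :
    IsClosed (S.nullSubmodule A hA : Set H) := by
  have : (S.nullSubmodule A hA : Set H) = ⋂ n, {f | S.scalar f (A ∩ cell n) = 0} := by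
    ext f; simp [mem_nullSubmodule, NullOn]
  rw [this]
  exact isClosed_iInter fun n => isClosed_eq (S.continuous_scalar _) continuous_const

lemma nullOn_iff_scalar_eq_zero (S : OperatorMeasure H) (f : H) {A : Set ℝ}
    (hA : MeasurableSet A) (hb : Bornology.IsBounded A) :
    S.NullOn f A ↔ S.scalar f A = 0 := by
  have hs := S.hasSum_scalar f (δ := fun n => A ∩ cell n)
    (fun n => hA.inter (measurableSet_cell n)) (pairwise_disjoint_inter_cell A)
    (by rwa [iUnion_inter_cell])
  rw [iUnion_inter_cell] at hs
  constructor
  · intro h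
    have : (fun n => S.scalar f (A ∩ cell n)) = fun _ => 0 := funext h
    rw [this] at hs
    exact hs.unique hasSum_zero
  · intro h n
    rw [h] at hs
    exact congrFun ((hasSum_zero_iff_of_nonneg fun n => S.scalar_nonneg f
      (hA.inter (measurableSet_cell n)) (isBounded_inter_cell A n)).1 hs) n

/-- Finite scalar measures on the line with the same null sets as the `μ_f`, and quadratic in
`f`. -/
lemma exists_finite_measures (S : OperatorMeasure H) :
    ∃ (ν : H → Measure ℝ) (C : ℝ≥0), (∀ f A, ν f A ≤ C * ‖f‖ₑ ^ 2) ∧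
      (∀ f g A, MeasurableSet A → ν (f + g) A ≤ 2 * (ν f A + ν g A)) ∧
      (∀ f A, MeasurableSet A → (ν f A = 0 ↔ S.NullOn f A)) := by
  -- Positive weights keep the null sets and make the total mass at most `‖f‖ₑ ^ 2`, so `C = 1`
  -- works.
  obtain ⟨w, hw0, hw⟩ := ENNReal.exists_pos_tsum_mul_lt_of_countable one_ne_zero
    (fun n => ‖S.toFun (cell n)‖ₑ) (fun n => by simp)
  have happ : ∀ f A, MeasurableSet A → (Measure.sum fun n => (w n : ℝ≥0∞) • S.cellMeasure f n) A
      = ∑' n, w n * ENNReal.ofReal (S.scalar f (A ∩ cell n)) := by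
    intro f A hA
    rw [Measure.sum_apply _ hA]
    exact tsum_congr fun n => by
      rw [Measure.smul_apply, smul_eq_mul, S.cellMeasure_apply f n hA]
  refine ⟨fun f => Measure.sum fun n => (w n : ℝ≥0∞) • S.cellMeasure f n, 1, ?_, ?_, ?_⟩
  · intro f A
    refine (measure_mono (subset_univ A)).trans ?_
    rw [Measure.sum_apply _ .univ, ENNReal.coe_one]
    refine le_trans ?_ (mul_le_mul_left hw.le _)
    rw [← ENNReal.tsum_mul_right]
    refine ENNReal.tsum_le_tsum fun n => ?_
    rw [Measure.smul_apply, smul_eq_mul]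
    refine (mul_le_mul_right (S.cellMeasure_le f n univ) _).trans_eq ?_
    ring
  · intro f g A hA
    rw [happ _ _ hA, happ _ _ hA, happ _ _ hA, ← ENNReal.tsum_add, ← ENNReal.tsum_mul_left]
    refine ENNReal.tsum_le_tsum fun n => ?_
    have hm := hA.inter (measurableSet_cell n)
    have hb := isBounded_inter_cell A n
    rw [← mul_add, mul_left_comm, ← ENNReal.ofReal_add (S.scalar_nonneg f hm hb)
      (S.scalar_nonneg g hm hb), ← ENNReal.ofReal_ofNat 2, ← ENNReal.ofReal_mul (by norm_num)]
    gcongr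
    exact S.scalar_add_le f g hm hb
  · intro f A hA
    rw [happ _ _ hA, ENNReal.tsum_eq_zero]
    refine forall_congr' fun n => ?_
    have h0 := S.scalar_nonneg f (hA.inter (measurableSet_cell n)) (isBounded_inter_cell A n)
    have hw' := (hw0 n).ne'
    rw [mul_eq_zero, ENNReal.coe_eq_zero, ENNReal.ofReal_eq_zero]
    exact ⟨fun h => le_antisymm (h.resolve_left hw') h0, fun h => Or.inr h.le⟩

end OperatorMeasure

/-! ### Measure theory: limsup sets and bounded multiplicity -/

lemma le_measure_limsup {α : Type*} [MeasurableSpace α] {τ : Measure α} [IsFiniteMeasure τ]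
    {A : ℕ → Set α} (hA : ∀ n, MeasurableSet (A n)) {c : ℝ≥0∞} (hc : ∀ n, c ≤ τ (A n)) :
    c ≤ τ (Filter.limsup A Filter.atTop) := by
  have heq : Filter.limsup A Filter.atTop = ⋂ n, ⋃ i ≥ n, A i := by
    rw [Filter.limsup_eq_iInf_iSup_of_nat]
    simp only [iInf_eq_iInter, iSup_eq_iUnion]
  rw [heq]
  have hanti : Antitone fun n => ⋃ i ≥ n, A i := fun m n hmn =>
    biUnion_subset_biUnion_left fun i (hi : n ≤ i) => hmn.trans hi
  have ht := tendsto_measure_iInter_atTop (μ := τ) (s := fun n => ⋃ i ≥ n, A i)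
    (fun n => (MeasurableSet.iUnion fun i =>
      MeasurableSet.iUnion fun _ => hA i).nullMeasurableSet) hanti ⟨0, measure_ne_top _ _⟩
  refine ge_of_tendsto' ht fun n => (hc n).trans (measure_mono ?_)
  exact subset_biUnion_of_mem (u := fun i => A i) (le_refl n)

/-- If the members of a sequence of sets intersect three by three inside a null set modulo `W`,
then most of them are essentially not larger than `W`. -/
lemma sum_measure_le_of_triple_inter {α : Type*} [MeasurableSpace α] (τ : Measure α)
    {A : ℕ → Set α} {W : Set α} (hA : ∀ n, MeasurableSet (A n)) (hW : MeasurableSet W)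
    (h : ∀ i j k, i ≠ j → i ≠ k → j ≠ k → τ ((A i ∩ A j ∩ A k) \ W) = 0) (n : ℕ) :
    ∑ k ∈ Finset.range n, τ (A k) ≤ n * τ W + 2 * τ univ := by
  classical
  have hae : ∀ᵐ x ∂τ, ∀ i j k, i ≠ j → i ≠ k → j ≠ k → x ∉ (A i ∩ A j ∩ A k) \ W := by
    simp only [ae_all_iff]
    exact fun i j k hij hik hjk => measure_eq_zero_iff_ae_notMem.1 (h i j k hij hik hjk)
  have hle : ∑ k ∈ Finset.range n, τ (A k \ W) ≤ 2 * τ univ := by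
    calc ∑ k ∈ Finset.range n, τ (A k \ W)
        = ∫⁻ x, ∑ k ∈ Finset.range n, (A k \ W).indicator 1 x ∂τ := by
          rw [lintegral_finsetSum _ fun k _ => measurable_one.indicator ((hA k).diff hW)]
          exact Finset.sum_congr rfl fun k _ =>
            (lintegral_indicator_one ((hA k).diff hW)).symm
      _ ≤ ∫⁻ _, 2 ∂τ := by
          -- Almost every point lies in at most two of the sets `A k \ W`.
          refine lintegral_mono_ae (hae.mono fun x hx => ?_)
          have hs : ∑ k ∈ Finset.range n, (A k \ W).indicator (1 : α → ℝ≥0∞) x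
              = (((Finset.range n).filter fun k => x ∈ A k \ W).card : ℝ≥0∞) := by
            simp only [indicator_apply, Pi.one_apply]
            rw [Finset.sum_boole]
          rw [hs]
          by_contra hlt
          have h3 : 2 < ((Finset.range n).filter fun k => x ∈ A k \ W).card := by
            exact_mod_cast not_le.1 hlt
          obtain ⟨i, j, k, hi, hj, hk, hij, hik, hjk⟩ := Finset.two_lt_card_iff.1 h3
          simp only [Finset.mem_filter] at hi hj hk
          exact hx i j k hij hik hjk ⟨⟨⟨hi.2.1, hj.2.1⟩, hk.2.1⟩, hi.2.2⟩
      _ = 2 * τ univ := by simp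
  calc ∑ k ∈ Finset.range n, τ (A k) ≤ ∑ k ∈ Finset.range n, (τ W + τ (A k \ W)) := by
        refine Finset.sum_le_sum fun k _ => ?_
        refine (measure_mono (t := W ∪ A k \ W) ?_).trans (measure_union_le _ _)
        intro x hx
        by_cases hxW : x ∈ W
        · exact Or.inl hxW
        · exact Or.inr ⟨hx, hxW⟩
    _ = n * τ W + ∑ k ∈ Finset.range n, τ (A k \ W) := by
        rw [Finset.sum_add_distrib]; simp
    _ ≤ _ := by gcongr

/-! ### Essential null sets and their semicontinuity -/

namespace OperatorMeasure

variable {H : Type*} [NormedAddCommGroup H] [InnerProductSpace ℂ H] [CompleteSpace H]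

/-- A finite measure of the type of `S`, together with, for each vector `f`, an essentially
largest Borel set on which `f` is null. -/
structure NullSystem (S : OperatorMeasure H) where
  /-- a finite measure of the type of `S` -/
  base : Measure ℝ
  isFinite : IsFiniteMeasure base
  /-- an essentially largest set on which `f` is null -/
  nullSet : H → Set ℝ
  measurableSet_nullSet : ∀ f, MeasurableSet (nullSet f)
  nullOn_iff : ∀ f A, MeasurableSet A → (S.NullOn f A ↔ base (A \ nullSet f) = 0)
  base_eq_zero_iff : ∀ A, MeasurableSet A → (base A = 0 ↔ ∀ f, S.NullOn f A)
  -- The diagonal gives semicontinuity in one vector; pairs are needed to integrate over two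
  -- independent Gaussian copies.
  isClosed_le : ∀ c : ℝ≥0∞,
    IsClosed {p : H × H | c ≤ base (nullSet p.1 ∩ nullSet p.2)}

instance {S : OperatorMeasure H} (N : S.NullSystem) : IsFiniteMeasure N.base := N.isFinite

/-- A dense sequence suffices, since the vectors null on `A` form a closed subspace; `toFinite`
restores finiteness without changing null sets. -/
lemma exists_dominating_measure [TopologicalSpace.SeparableSpace H] (S : OperatorMeasure H) :
    ∃ τ : Measure ℝ, IsFiniteMeasure τ ∧
      ∀ A, MeasurableSet A → (τ A = 0 ↔ ∀ f, S.NullOn f A) := by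
  obtain ⟨ν, C, hC, -, hnull⟩ := S.exists_finite_measures
  have hfin : ∀ f, IsFiniteMeasure (ν f) := fun f =>
    ⟨(hC f univ).trans_lt (ENNReal.mul_lt_top (by simp) (by simp))⟩
  refine ⟨(Measure.sum fun n => ν (TopologicalSpace.denseSeq H n)).toFinite,
    inferInstance, fun A hA => ?_⟩
  rw [toFinite_apply_eq_zero_iff, Measure.sum_apply_eq_zero' hA]
  refine ⟨fun h f => ?_, fun h n => (hnull _ _ hA).2 (h _)⟩
  have hsub : range (TopologicalSpace.denseSeq H) ⊆ S.nullSubmodule A hA := by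
    rintro _ ⟨n, rfl⟩
    exact (hnull _ _ hA).1 (h n)
  exact (S.isClosed_nullSubmodule hA).closure_subset_iff.2 hsub ((TopologicalSpace.denseRange_denseSeq H) f)

/-- The null set of `f` is the zero set of the density of `ν f` with respect to τ. For closedness,
approximate `p` geometrically fast: the limsup of the approximating intersections keeps mass `c`
and, by Borel–Cantelli, lies essentially in both null sets of `p`. -/
lemma nonempty_nullSystem [TopologicalSpace.SeparableSpace H] (S : OperatorMeasure H) :
    Nonempty S.NullSystem := by
  obtain ⟨τ, hτ, hτ0⟩ := S.exists_dominating_measure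
  obtain ⟨ν, C, hC, hadd, hnull⟩ := S.exists_finite_measures
  have hfin : ∀ f, IsFiniteMeasure (ν f) := fun f =>
    ⟨(hC f univ).trans_lt (ENNReal.mul_lt_top (by simp) (by simp))⟩
  have hac : ∀ f, ν f ≪ τ := fun f => Measure.AbsolutelyContinuous.mk fun A hA h =>
    (hnull f A hA).2 ((hτ0 A hA).1 h f)
  set Z : H → Set ℝ := fun f => {x | (ν f).rnDeriv τ x = 0} with hZ
  have hZm : ∀ f, MeasurableSet (Z f) := fun f =>
    (Measure.measurable_rnDeriv _ _) (measurableSet_singleton 0)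
  have hZi : ∀ f A, MeasurableSet A → (ν f A = 0 ↔ τ (A \ Z f) = 0) := by
    intro f A hA
    rw [← Measure.setLIntegral_rnDeriv (hac f) A,
      setLIntegral_eq_zero_iff hA (Measure.measurable_rnDeriv _ _), ae_iff]
    have : {a | ¬(a ∈ A → (ν f).rnDeriv τ a = 0)} = A \ Z f := by
      ext x; simp [hZ]
    rw [this]
  refine ⟨⟨τ, hτ, Z, hZm, fun f A hA => (hnull f A hA).symm.trans (hZi f A hA), hτ0,
    fun c => ?_⟩⟩
  refine isClosed_of_closure_subset fun p hp => ?_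
  have hex : ∀ n : ℕ, ∃ q : H × H, c ≤ τ (Z q.1 ∩ Z q.2) ∧ dist p q < (1 / 2 : ℝ) ^ n :=
    fun n => by
      obtain ⟨q, hq, hd⟩ := Metric.mem_closure_iff.1 hp ((1 / 2 : ℝ) ^ n) (by positivity)
      exact ⟨q, hq, hd⟩
  choose q hq hd using hex
  set A : ℕ → Set ℝ := fun n => Z (q n).1 ∩ Z (q n).2 with hAdef
  have hAm : ∀ n, MeasurableSet (A n) := fun n => (hZm _).inter (hZm _)
  have hLm : MeasurableSet (Filter.limsup A Filter.atTop) := .measurableSet_limsup hAm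
  have hlim : ∀ (f : H) (g : ℕ → H), (∀ n, dist f (g n) < (1 / 2 : ℝ) ^ n) →
      (∀ n, A n ⊆ Z (g n)) → τ (Filter.limsup A Filter.atTop \ Z f) = 0 := by
    intro f g hfg hAg
    rw [← hZi f _ hLm]
    apply measure_limsup_atTop_eq_zero
    have hb : ∀ n, ν f (A n) ≤ 2 * C * (2⁻¹ : ℝ≥0∞) ^ n := by
      intro n
      have h0 : ν (g n) (A n) = 0 :=
        (hZi _ _ (hAm n)).2 (by rw [sdiff_eq_empty.2 (hAg n), measure_empty])
      have h1 := hadd (g n) (f - g n) (A n) (hAm n)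
      -- As `g n` is null on `A n`, only the small vector `f - g n` contributes there.
      rw [add_sub_cancel, h0, zero_add] at h1
      refine h1.trans ?_
      rw [mul_assoc]
      refine mul_le_mul_right ?_ _
      have h2 : ‖f - g n‖ₑ ≤ (2⁻¹ : ℝ≥0∞) ^ n := by
        rw [← edist_eq_enorm_sub, edist_dist]
        refine (ENNReal.ofReal_le_ofReal (hfg n).le).trans_eq ?_
        rw [ENNReal.ofReal_pow (by norm_num), one_div, ENNReal.ofReal_inv_of_pos (by norm_num),
          ENNReal.ofReal_ofNat]
      have h3 : (2⁻¹ : ℝ≥0∞) ^ n ≤ 1 := pow_le_one₀ (by simp) (by simp)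
      have h4 : ‖f - g n‖ₑ ^ 2 ≤ (2⁻¹ : ℝ≥0∞) ^ n := by
        calc ‖f - g n‖ₑ ^ 2 = ‖f - g n‖ₑ * ‖f - g n‖ₑ := sq _
          _ ≤ (2⁻¹ : ℝ≥0∞) ^ n * 1 := mul_le_mul' h2 (h2.trans h3)
          _ = _ := mul_one _
      exact (hC _ _).trans (mul_le_mul_right h4 _)
    refine ne_top_of_le_ne_top ?_ (ENNReal.tsum_le_tsum hb)
    rw [ENNReal.tsum_mul_left, ENNReal.tsum_geometric]
    exact ENNReal.mul_ne_top (ENNReal.mul_ne_top (by simp) (by simp)) (by simp)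
  have h1 := hlim p.1 (fun n => (q n).1)
    (fun n => (le_max_left _ _).trans_lt (hd n)) fun n => inter_subset_left
  have h2 := hlim p.2 (fun n => (q n).2)
    (fun n => (le_max_right _ _).trans_lt (hd n)) fun n => inter_subset_right
  refine (le_measure_limsup hAm hq).trans (measure_mono_ae ?_)
  refine ae_le_set.2 ?_
  rw [sdiff_inter]
  exact measure_union_null h1 h2

end OperatorMeasure

/-! ### Two elementary facts for the counting arguments -/

lemma ENNReal.le_of_forall_nat_mul_le {a b C : ℝ≥0∞} (hC : C ≠ ∞)
    (h : ∀ n : ℕ, n * a ≤ n * b + C) : a ≤ b := by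
  refine ENNReal.le_of_forall_pos_le_add fun ε hε _ => ?_
  have hε' : (ε : ℝ≥0∞) ≠ 0 := by simpa using hε.ne'
  obtain ⟨n, hn⟩ := ENNReal.exists_nat_gt (ENNReal.div_ne_top hC hε')
  have hn0 : (n : ℝ≥0∞) ≠ 0 := (pos_of_gt hn).ne'
  have hCn : C ≤ n * ε := by
    rw [← ENNReal.div_le_iff hε' (by simp)]
    exact hn.le
  rw [← ENNReal.mul_le_mul_iff_right hn0 (ENNReal.natCast_ne_top n), mul_add]
  exact (h n).trans (by gcongr)

/-- Three distinct points of the unit circle are not collinear. -/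
lemma circle_det_ne_zero {c₁ s₁ c₂ s₂ c₃ s₃ : ℝ} (h₁ : c₁ ^ 2 + s₁ ^ 2 = 1)
    (h₂ : c₂ ^ 2 + s₂ ^ 2 = 1) (h₃ : c₃ ^ 2 + s₃ ^ 2 = 1) (h₁₂ : c₁ ≠ c₂) (h₁₃ : c₁ ≠ c₃)
    (h₂₃ : c₂ ≠ c₃) : (c₁ - c₂) * (s₁ - s₃) - (c₁ - c₃) * (s₁ - s₂) ≠ 0 := by
  intro h
  have ha : c₁ - c₂ ≠ 0 := sub_ne_zero.2 h₁₂
  have hb : c₁ - c₃ ≠ 0 := sub_ne_zero.2 h₁₃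
  have hc : c₂ - c₃ ≠ 0 := sub_ne_zero.2 h₂₃
  -- Along the line through the first two points, the squared norm minus one is a quadratic
  -- vanishing at both, with leading coefficient their squared distance; evaluate it at the third
  -- point.
  have key : (c₁ - c₂) * (c₁ - c₃) * (c₂ - c₃) * ((c₁ - c₂) ^ 2 + (s₁ - s₂) ^ 2) = 0 := by
    grind
  have : 0 < (c₁ - c₂) ^ 2 + (s₁ - s₂) ^ 2 := by positivity
  simp_all

namespace OperatorMeasure

variable {H : Type*} [NormedAddCommGroup H] [InnerProductSpace ℂ H] [CompleteSpace H]
  {S : OperatorMeasure H}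

/-! ### Vectors of maximal type: Borel class and category -/

namespace NullSystem

lemma nullOn_of_subset (N : S.NullSystem) {f : H} {A : Set ℝ} (hA : MeasurableSet A)
    (h : A ⊆ N.nullSet f) : S.NullOn f A :=
  (N.nullOn_iff f A hA).2 (by rw [sdiff_eq_empty.2 h, measure_empty])

lemma mem_maximalType_iff (N : S.NullSystem) {f : H} :
    f ∈ S.maximalType ↔ N.base (N.nullSet f) = 0 := by
  have hm := N.measurableSet_nullSet f
  constructor
  · rintro ⟨h, -⟩
    refine (N.base_eq_zero_iff _ hm).2 fun g n => ?_
    have h0 := h _ (hm.inter (measurableSet_cell n)) (isBounded_inter_cell _ n)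
      (N.nullOn_of_subset hm subset_rfl n)
    simp [scalar_eq, h0]
  · intro h
    refine ⟨fun δ hδ hb hz => ?_, fun δ hδ hb hz => by simp [scalar_eq, hz]⟩
    have h1 := (N.nullOn_iff f δ hδ).1 ((S.nullOn_iff_scalar_eq_zero f hδ hb).2 hz)
    have h2 : N.base δ = 0 :=
      measure_mono_null (subset_sdiff_union δ (N.nullSet f)) (measure_union_null h1 h)
    exact S.toFun_eq_zero hδ hb fun g =>
      (S.nullOn_iff_scalar_eq_zero g hδ hb).1 ((N.base_eq_zero_iff δ hδ).1 h2 g)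

lemma isClosed_le_base (N : S.NullSystem) (c : ℝ≥0∞) :
    IsClosed {f : H | c ≤ N.base (N.nullSet f)} := by
  have := (N.isClosed_le c).preimage (f := fun f : H => (f, f)) (by fun_prop)
  simpa [preimage] using this

lemma isOpen_base_lt (N : S.NullSystem) (c : ℝ≥0∞) :
    IsOpen {f : H | N.base (N.nullSet f) < c} := by
  simpa [compl_ofPred, not_le] using (N.isClosed_le_base c).isOpen_compl

/-- Most vectors of a complex line in direction `g` through `f` have a null set essentially
contained in those of `f` and `g`. -/
lemma exists_base_lt (N : S.NullSystem) (f g : H) {c : ℕ → ℂ} (hc : Function.Injective c)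
    {b : ℝ≥0∞} (hb : N.base (N.nullSet f ∩ N.nullSet g) < b) :
    ∃ k, N.base (N.nullSet (f + c k • g)) < b := by
  by_contra! hcon
  refine hb.not_ge (ENNReal.le_of_forall_nat_mul_le (C := 2 * N.base univ)
    (ENNReal.mul_ne_top (by simp) (by simp)) fun n => ?_)
  refine le_trans ?_ (sum_measure_le_of_triple_inter N.base
    (A := fun k => N.nullSet (f + c k • g)) (fun k => N.measurableSet_nullSet _)
    ((N.measurableSet_nullSet f).inter (N.measurableSet_nullSet g)) ?_ n)
  · calc (n : ℝ≥0∞) * b = ∑ _k ∈ Finset.range n, b := by simp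
      _ ≤ _ := Finset.sum_le_sum fun k _ => hcon k
  · intro i j k hij _ _
    set A := N.nullSet (f + c i • g) ∩ N.nullSet (f + c j • g) ∩ N.nullSet (f + c k • g)
    have hA : MeasurableSet A := ((N.measurableSet_nullSet _).inter
      (N.measurableSet_nullSet _)).inter (N.measurableSet_nullSet _)
    have hi : f + c i • g ∈ S.nullSubmodule A hA :=
      N.nullOn_of_subset hA (inter_subset_left.trans inter_subset_left)
    have hj : f + c j • g ∈ S.nullSubmodule A hA :=
      N.nullOn_of_subset hA (inter_subset_left.trans inter_subset_right)
    -- Two distinct points of the line already recover `g`, then `f`.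
    have hg : g ∈ S.nullSubmodule A hA := by
      have h := Submodule.sub_mem _ hi hj
      rw [add_sub_add_left_eq_sub, ← sub_smul] at h
      exact (Submodule.smul_mem_iff _ (sub_ne_zero.2 (hc.ne hij))).1 h
    have hf : f ∈ S.nullSubmodule A hA :=
      (Submodule.add_mem_iff_left _ (Submodule.smul_mem _ _ hg)).1 hi
    rw [sdiff_inter]
    exact measure_union_null ((N.nullOn_iff f A hA).1 hf) ((N.nullOn_iff g A hA).1 hg)

lemma dense_base_lt (N : S.NullSystem) {b : ℝ≥0∞} (h : ∃ g, N.base (N.nullSet g) < b) :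
    Dense {f : H | N.base (N.nullSet f) < b} := by
  obtain ⟨g, hg⟩ := h
  refine dense_iff_inter_open.2 fun U hU ⟨f, hf⟩ => ?_
  have ht : Filter.Tendsto (fun k : ℕ => f + ((1 / ((k : ℝ) + 1) : ℝ) : ℂ) • g) Filter.atTop
      (𝓝 (f + ((0 : ℝ) : ℂ) • g)) :=
    (((Complex.continuous_ofReal.tendsto 0).comp
      tendsto_one_div_add_atTop_nhds_zero_nat).smul_const g).const_add f
  have hU' : U ∈ 𝓝 (f + ((0 : ℝ) : ℂ) • g) := by simpa using hU.mem_nhds hf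
  obtain ⟨K, hK⟩ := Filter.eventually_atTop.1 (ht.eventually hU')
  -- The shift by `K` keeps every candidate inside `U`.
  obtain ⟨k, hk⟩ := N.exists_base_lt f g
    (c := fun k : ℕ => ((1 / (((k + K : ℕ) : ℝ) + 1) : ℝ) : ℂ)) (by
      intro i j hij
      have h1 := Complex.ofReal_injective hij
      rw [div_eq_div_iff (by positivity) (by positivity)] at h1
      push_cast at h1
      have : (i : ℝ) = j := by linarith
      exact_mod_cast this)
    ((measure_mono inter_subset_right).trans_lt hg)
  exact ⟨_, hK (k + K) (Nat.le_add_left _ _), hk⟩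

lemma base_eq_zero_of_forall_diff (N : S.NullSystem) {f : H}
    (h : ∀ g, N.base (N.nullSet f \ N.nullSet g) = 0) : N.base (N.nullSet f) = 0 :=
  (N.base_eq_zero_iff _ (N.measurableSet_nullSet f)).2 fun g =>
    (N.nullOn_iff g _ (N.measurableSet_nullSet f)).2 (h g)

lemma base_diff_eq_zero (N : S.NullSystem) {f g : H}
    (h : N.base (N.nullSet f) ≤ N.base (N.nullSet f ∩ N.nullSet g)) :
    N.base (N.nullSet f \ N.nullSet g) = 0 := by
  rw [← sdiff_self_inter, measure_sdiff inter_subset_left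
    ((N.measurableSet_nullSet f).inter (N.measurableSet_nullSet g)).nullMeasurableSet
    (measure_ne_top _ _)]
  exact tsub_eq_zero_of_le h

lemma base_eq_zero_of_forall_le (N : S.NullSystem) {f : H}
    (h : ∀ g, N.base (N.nullSet f) ≤ N.base (N.nullSet g)) : N.base (N.nullSet f) = 0 := by
  refine N.base_eq_zero_of_forall_diff fun g => N.base_diff_eq_zero ?_
  by_contra! hlt
  obtain ⟨k, hk⟩ := N.exists_base_lt f g (c := fun k : ℕ => (k : ℂ)) Nat.cast_injective hlt
  exact hk.not_ge (h _)

lemma setOf_base_le (N : S.NullSystem) {c : ℝ≥0∞} :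
    {f : H | N.base (N.nullSet f) ≤ c}
      = ⋂ n : ℕ, {f | N.base (N.nullSet f) < c + (n : ℝ≥0∞)⁻¹} := by
  by_cases hc : c = ∞
  · ext f; simp [hc, measure_lt_top]
  ext f
  simp only [mem_ofPred_eq, mem_iInter]
  constructor
  -- The index `n = 0` is harmless: the inverse is `∞` and the base measure is finite.
  · exact fun h n => h.trans_lt (ENNReal.lt_add_right hc (by simp))
  · intro h
    have ht : Filter.Tendsto (fun n : ℕ => c + (n : ℝ≥0∞)⁻¹) Filter.atTop (𝓝 (c + 0)) :=
      ENNReal.tendsto_inv_nat_nhds_zero.const_add c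
    rw [add_zero] at ht
    exact ge_of_tendsto' ht fun n => (h n).le

lemma dense_maximalType (N : S.NullSystem) : Dense S.maximalType := by
  set c : ℝ≥0∞ := ⨅ g, N.base (N.nullSet g) with hc
  have hctop : c ≠ ∞ := ne_top_of_le_ne_top (measure_ne_top N.base _) (iInf_le _ (0 : H))
  have hd : Dense {f : H | N.base (N.nullSet f) ≤ c} := by
    rw [N.setOf_base_le]
    refine dense_iInter_of_isOpen_nat (fun n => N.isOpen_base_lt _) fun n =>
      N.dense_base_lt (iInf_lt_iff.1 (ENNReal.lt_add_right hctop (by simp)))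
  exact hd.mono fun f hf => N.mem_maximalType_iff.2
    (N.base_eq_zero_of_forall_le fun g => le_trans hf (iInf_le _ g))

lemma maximalType_eq_iInter (N : S.NullSystem) :
    S.maximalType = ⋂ n : ℕ, {f | N.base (N.nullSet f) < (n : ℝ≥0∞)⁻¹} := by
  have := N.setOf_base_le (c := 0)
  simp only [nonpos_iff_eq_zero, zero_add] at this
  rw [← this]
  ext f
  exact N.mem_maximalType_iff

lemma isFsigma_compl_maximalType (N : S.NullSystem) : IsFsigma (S.maximalType)ᶜ := by
  refine ⟨fun n => {f | N.base (N.nullSet f) < (n : ℝ≥0∞)⁻¹}ᶜ,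
    fun n => (N.isOpen_base_lt _).isClosed_compl, ?_⟩
  rw [N.maximalType_eq_iInter, compl_iInter]

lemma isMeagre_compl_maximalType (N : S.NullSystem) : IsMeagre (S.maximalType)ᶜ := by
  rw [IsMeagre, compl_compl]
  refine residual_of_dense_Gδ ?_ N.dense_maximalType
  rw [N.maximalType_eq_iInter]
  exact .iInter_of_isOpen fun n => N.isOpen_base_lt _

/-! ### Gaussian measures -/

/-- Three noncollinear points of the circle affinely span the plane through `m` in the directions
`u`, `v`: differences yield `u` and `v` by Cramer's rule, then `m` follows. The shift `m` is why
three points are needed instead of two. -/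
lemma triple_circle_null (N : S.NullSystem) (m u v : H) {c s : ℕ → ℝ}
    (hcs : ∀ k, c k ^ 2 + s k ^ 2 = 1) (hc : Function.Injective c) (i j k : ℕ) (hij : i ≠ j)
    (hik : i ≠ k) (hjk : j ≠ k) :
    N.base ((N.nullSet (c i • u + s i • v + m) ∩ N.nullSet (c j • u + s j • v + m) ∩
      N.nullSet (c k • u + s k • v + m)) \ (N.nullSet (u + m) ∩ N.nullSet (v + m))) = 0 := by
  set A := N.nullSet (c i • u + s i • v + m) ∩ N.nullSet (c j • u + s j • v + m) ∩
      N.nullSet (c k • u + s k • v + m)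
  have hA : MeasurableSet A := ((N.measurableSet_nullSet _).inter
    (N.measurableSet_nullSet _)).inter (N.measurableSet_nullSet _)
  set K : Submodule ℝ H := (S.nullSubmodule A hA).restrictScalars ℝ
  have hi : c i • u + s i • v + m ∈ K :=
    N.nullOn_of_subset hA (inter_subset_left.trans inter_subset_left)
  have hj : c j • u + s j • v + m ∈ K :=
    N.nullOn_of_subset hA (inter_subset_left.trans inter_subset_right)
  have hk : c k • u + s k • v + m ∈ K := N.nullOn_of_subset hA inter_subset_right
  have hD := circle_det_ne_zero (hcs i) (hcs j) (hcs k) (hc.ne hij) (hc.ne hik) (hc.ne hjk)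
  have hij' := K.sub_mem hi hj
  have hik' := K.sub_mem hi hk
  have hu : u ∈ K := by
    refine (K.smul_mem_iff hD).1 ?_
    convert K.sub_mem (K.smul_mem (s i - s k) hij') (K.smul_mem (s i - s j) hik') using 1
    module
  have hv : v ∈ K := by
    refine (K.smul_mem_iff hD).1 ?_
    convert K.sub_mem (K.smul_mem (c i - c j) hik') (K.smul_mem (c i - c k) hij') using 1
    module
  have hm : m ∈ K :=
    (K.add_mem_iff_right (K.add_mem (K.smul_mem _ hu) (K.smul_mem _ hv))).1 hi
  rw [sdiff_inter]
  exact measure_union_null ((N.nullOn_iff _ A hA).1 (K.add_mem hu hm))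
    ((N.nullOn_iff _ A hA).1 (K.add_mem hv hm))

lemma measurable_base [MeasurableSpace H] [BorelSpace H] (N : S.NullSystem) :
    Measurable fun f : H => N.base (N.nullSet f) :=
  measurable_of_Ici fun c => (N.isClosed_le_base c).measurableSet

section Gaussian

variable [TopologicalSpace.SeparableSpace H] [MeasurableSpace H] [BorelSpace H]

lemma measurable_base_inter (N : S.NullSystem) :
    Measurable fun p : H × H => N.base (N.nullSet p.1 ∩ N.nullSet p.2) := by
  have := UniformSpace.secondCountable_of_separable H
  exact measurable_of_Ici fun c => (N.isClosed_le c).measurableSet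

/-- The null sets of two independent copies of a shifted centred Gaussian vector essentially
contain each other. -/
lemma ae_prod_base_diff (N : S.NullSystem) (ω : Measure H) [IsGaussian ω] (hω : ω[id] = 0)
    (m : H) : ∀ᵐ p ∂(ω.prod ω), N.base (N.nullSet (p.1 + m) \ N.nullSet (p.2 + m)) = 0 := by
  have := UniformSpace.secondCountable_of_separable H
  set F : H → ℝ≥0∞ := fun x => N.base (N.nullSet (x + m)) with hF
  have hFm : Measurable F := N.measurable_base.comp (by fun_prop)
  set G : H × H → ℝ≥0∞ := fun p => N.base (N.nullSet (p.1 + m) ∩ N.nullSet (p.2 + m)) with hG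
  have hGm : Measurable G := N.measurable_base_inter.comp
    (g := fun p : H × H => N.base (N.nullSet p.1 ∩ N.nullSet p.2))
    (f := fun p : H × H => (p.1 + m, p.2 + m)) (by fun_prop)
  -- The centred product measure is rotation invariant, so the integral does not depend on the
  -- angle.
  have hrot : ∀ θ : ℝ, ∫⁻ p, F (Real.cos θ • p.1 + Real.sin θ • p.2) ∂(ω.prod ω)
      = ∫⁻ p, F p.1 ∂(ω.prod ω) := by
    intro θ
    conv_rhs => rw [← IsGaussian.map_rotation_eq_self hω θ]
    exact (lintegral_map (f := fun p : H × H => F p.1) (hFm.comp measurable_fst)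
      (by fun_prop : Measurable (ContinuousLinearMap.rotation (E := H) θ))).symm
  -- Distinct angles in `[0, π]`, where the cosine is injective.
  set θ : ℕ → ℝ := fun k => 1 / ((k : ℝ) + 1) with hθ
  have hinj : Function.Injective fun k => Real.cos (θ k) := by
    have hmem : ∀ k, θ k ∈ Icc 0 Real.pi := fun k => by
      refine ⟨by positivity, ?_⟩
      have : θ k ≤ 1 := by
        rw [hθ, div_le_one (by positivity)]
        linarith [(Nat.cast_nonneg k : (0 : ℝ) ≤ k)]
      linarith [Real.pi_gt_three]
    intro i j hij
    have h1 := Real.injOn_cos (hmem i) (hmem j) hij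
    have h2 : (i : ℝ) + 1 = j + 1 := by simpa [hθ] using h1
    have : (i : ℝ) = j := by linarith
    exact_mod_cast this
  have hpt : ∀ (n : ℕ) (p : H × H),
      ∑ k ∈ Finset.range n, F (Real.cos (θ k) • p.1 + Real.sin (θ k) • p.2)
        ≤ n * G p + 2 * N.base univ := fun n p =>
    sum_measure_le_of_triple_inter N.base
      (A := fun k => N.nullSet (Real.cos (θ k) • p.1 + Real.sin (θ k) • p.2 + m))
      (fun k => N.measurableSet_nullSet _)
      ((N.measurableSet_nullSet _).inter (N.measurableSet_nullSet _))
      (N.triple_circle_null m p.1 p.2 (c := fun k => Real.cos (θ k))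
        (s := fun k => Real.sin (θ k)) (fun k => Real.cos_sq_add_sin_sq _) hinj) n
  have hle : ∫⁻ p, F p.1 ∂(ω.prod ω) ≤ ∫⁻ p, G p ∂(ω.prod ω) := by
    refine ENNReal.le_of_forall_nat_mul_le (C := 2 * N.base univ)
      (ENNReal.mul_ne_top (by simp) (by simp)) fun n => ?_
    calc (n : ℝ≥0∞) * ∫⁻ p, F p.1 ∂(ω.prod ω)
        = ∑ k ∈ Finset.range n,
            ∫⁻ p, F (Real.cos (θ k) • p.1 + Real.sin (θ k) • p.2) ∂(ω.prod ω) := by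
          simp [hrot]
      _ = ∫⁻ p, ∑ k ∈ Finset.range n,
            F (Real.cos (θ k) • p.1 + Real.sin (θ k) • p.2) ∂(ω.prod ω) :=
          (lintegral_finsetSum _ fun k _ => hFm.comp (by fun_prop)).symm
      _ ≤ ∫⁻ p, (n * G p + 2 * N.base univ) ∂(ω.prod ω) := lintegral_mono (hpt n)
      _ = n * ∫⁻ p, G p ∂(ω.prod ω) + 2 * N.base univ := by
          rw [lintegral_add_right _ measurable_const, lintegral_const_mul _ hGm]
          simp
  have hGF : ∀ p, G p ≤ F p.1 := fun p => measure_mono inter_subset_left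
  have hfin : ∫⁻ p, G p ∂(ω.prod ω) ≠ ∞ := by
    refine ne_top_of_le_ne_top (b := N.base univ) (measure_ne_top _ _) ?_
    calc ∫⁻ p, G p ∂(ω.prod ω) ≤ ∫⁻ _, N.base univ ∂(ω.prod ω) :=
          lintegral_mono fun p => measure_mono (subset_univ _)
      _ = N.base univ := by simp
  -- Since `G p ≤ F p.1` pointwise, the reverse inequality of finite integrals forces equality
  -- almost everywhere.
  have hae := ae_eq_of_ae_le_of_lintegral_le (Filter.Eventually.of_forall hGF) hfin
    (hFm.comp measurable_fst).aemeasurable hle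
  filter_upwards [hae] with p hp
  exact N.base_diff_eq_zero hp.ge

lemma measure_maximalType (N : S.NullSystem) (ω : Measure H) [IsGaussian ω]
    (hnd : IsNondegenerate ω) : ω S.maximalType = 1 := by
  have := UniformSpace.secondCountable_of_separable H
  set m : H := ω[id] with hm
  have hmeas : Measurable fun x : H => x - m := by fun_prop
  have hcent : (ω.map fun x => x - m)[id] = 0 := by
    rw [integral_map hmeas.aemeasurable (by fun_prop)]
    simp only [id_eq]
    rw [integral_sub (f := fun x => x) IsGaussian.integrable_id (integrable_const _)]
    simp [hm]
  have hprod := Measure.ae_ae_of_ae_prod (N.ae_prod_base_diff (ω.map fun x => x - m) hcent m)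
  have hae : ∀ᵐ x ∂ω, x ∈ S.maximalType := by
    filter_upwards [ae_of_ae_map hmeas.aemeasurable hprod] with x hx
    have hx' := ae_of_ae_map hmeas.aemeasurable hx
    simp only [sub_add_cancel] at hx'
    have hA := N.measurableSet_nullSet x
    -- With `x` fixed, almost every `y` is null on the null set of `x`, so this closed subspace has
    -- measure one.
    have htop : S.nullSubmodule _ hA = ⊤ := by
      by_contra hne
      refine hnd _ (S.isClosed_nullSubmodule hA) hne ?_
      rw [← mem_ae_iff_prob_eq_one (S.isClosed_nullSubmodule hA).measurableSet]
      filter_upwards [hx'] with y hy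
      exact (N.nullOn_iff y _ hA).2 hy
    refine N.mem_maximalType_iff.2 ((N.base_eq_zero_iff _ hA).2 fun g => ?_)
    have : g ∈ S.nullSubmodule _ hA := htop ▸ Submodule.mem_top
    exact this
  have hmt : MeasurableSet S.maximalType := by
    rw [N.maximalType_eq_iInter]
    exact .iInter fun n => (N.isOpen_base_lt _).measurableSet
  exact (mem_ae_iff_prob_eq_one hmt).1 hae

end Gaussian

end NullSystem

end OperatorMeasure

theorem theorem3 {H : Type*} [NormedAddCommGroup H] [InnerProductSpace ℂ H] [CompleteSpace H]
    [TopologicalSpace.SeparableSpace H] [MeasurableSpace H] [BorelSpace H]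
    (S : OperatorMeasure H) :
    (IsFsigma (S.maximalType)ᶜ ∧ IsMeagre (S.maximalType)ᶜ) ∧
    (∀ ω : Measure H, IsGaussian ω → IsNondegenerate ω → ω S.maximalType = 1) ∧
    (S.maximalType.Nonempty ∧ Dense S.maximalType) := by
  obtain ⟨N⟩ := S.nonempty_nullSystem
  exact ⟨⟨N.isFsigma_compl_maximalType, N.isMeagre_compl_maximalType⟩,
    fun ω _ hnd => N.measure_maximalType ω hnd, N.dense_maximalType.nonempty,
    N.dense_maximalType⟩
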